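/- Let $E$ and $F$ be finite sets. A bimatroid $\mathsf{A}$ on $E\times F$ is given by a set $\mathcal{R}$ of pairs $(I,J)$ with $I\subseteq E$, $J\subseteq F$, $|I|=|J|$, called regular minors, such that $(\emptyset,\emptyset)\in\mathcal{R}$ and, for all $(I,J),(I',J')\in\mathcal{R}$: (a) for every $i'\in I'\setminus I$, there is $i\in I\setminus I'$ with $\big((I\setminus\{i\})\cup\{i'\},J\big)\in\mathcal{R}$, or there is $j'\in J'\setminus J$ with $\big(I\cup\{i'\},J\cup\{j'\}\big)\in\mathcal{R}$; (b) for every $j\in J\setminus J'$, there is $j'\in J'\setminus J$ with $\big(I,(J\setminus\{j\})\cup\{j'\}\big)\in\mathcal{R}$, or there is $i\in I\setminus I'$ with $\big(I\setminus\{i\},J\setminus\{j\}\big)\in\mathcal{R}$. For $S\subseteq E$ and $T\subseteq F$ let $r(S,T)$ be the maximal $d\ge 0$ for which there is $(I,J)\in\mathcal{R}$ with $I\subseteq S$, $J\subseteq T$ and $|I|=|J|=d$. Call $(S,T)$ a vertical regular rectangle if $r(S,T)=|T|\le|S|$, and a horizontal regular rectangle if $r(S,T)=|S|\le|T|$. **Theorem.**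 Let $\mathsf{A}$ be a bimatroid on $E\times F$ and let $N=|E|+|F|$. Let $RR^{\updownarrow}_k$ be the number of vertical regular rectangles $(S,T)$ with $|T|=k$ ($k$ columns), and $RR^{\leftrightarrow}_k$ the number of horizontal regular rectangles $(S,T)$ with $|S|=k$ ($k$ rows). Then both sequences are ultra log-concave with respect to $N$. That is, they vanish for $k>N$, they have no internal zeros (if the $i$-th and $j$-th terms are non-zero, then so is the $k$-th for all $i<k<j$), and for all $k\ge 1$ $$\frac{(RR^{\updownarrow}_k)^2}{\binom{N}{k}^2}\ \ge\ \frac{RR^{\updownarrow}_{k-1}}{\binom{N}{k-1}}\cdot\frac{RR^{\updownarrow}_{k+1}}{\binom{N}{k+1}} \qquad\text{and}\qquad \frac{(RR^{\leftrightarrow}_k)^2}{\binom{N}{k}^2}\ \ge\ \frac{RR^{\leftrightarrow}_{k-1}}{\binom{N}{k-1}}\cdot\frac{RR^{\leftrightarrow}_{k+1}}{\binom{N}{k+1}},$$ where quotients of the form $0/0$, which occur only for indices exceeding $N$, are read as $0$. -/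

import Mathlib

/-- A bimatroid on the ground set `E × F`, given by its set of regular minors: a set of pairs
`(I, J)` of subsets `I ⊆ E`, `J ⊆ F` of equal size, containing `(∅, ∅)` and subject to the two
exchange axioms. -/
structure Bimatroid (E : Type*) (F : Type*) [DecidableEq E] [DecidableEq F] where
  /-- `IsRegularMinor I J` says that `(I, J)` is a regular minor. -/
  IsRegularMinor : Finset E → Finset F → Prop
  card_eq : ∀ I J, IsRegularMinor I J → I.card = J.card
  empty : IsRegularMinor ∅ ∅
  exchange_row : ∀ I J I' J', IsRegularMinor I J → IsRegularMinor I' J' → ∀ i' ∈ I' \ I,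
    (∃ i ∈ I \ I', IsRegularMinor (insert i' (I.erase i)) J) ∨
    (∃ j' ∈ J' \ J, IsRegularMinor (insert i' I) (insert j' J))
  exchange_col : ∀ I J I' J', IsRegularMinor I J → IsRegularMinor I' J' → ∀ j ∈ J \ J',
    (∃ j' ∈ J' \ J, IsRegularMinor I (insert j' (J.erase j))) ∨
    (∃ i ∈ I \ I', IsRegularMinor (I.erase i) (J.erase j))

namespace Bimatroid

variable {E : Type*} {F : Type*} [DecidableEq E] [DecidableEq F]

open Classical in
/-- The relative rank `r(S, T)`: the largest size of a regular minor `(I, J)` with `I ⊆ S` and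
`J ⊆ T` (the maximum is over a nonempty finite set, since `(∅, ∅)` is a regular minor). -/
noncomputable def relRank (A : Bimatroid E F) (S : Finset E) (T : Finset F) : ℕ :=
  ((S.powerset ×ˢ T.powerset).filter fun p => A.IsRegularMinor p.1 p.2).sup fun p => p.1.card

/-- `(S, T)` is a vertical regular rectangle: `r(S, T) = |T| ≤ |S|`. -/
def IsVerticalRegularRectangle (A : Bimatroid E F) (S : Finset E) (T : Finset F) : Prop :=
  A.relRank S T = T.card ∧ T.card ≤ S.card

/-- `(S, T)` is a horizontal regular rectangle: `r(S, T) = |S| ≤ |T|`. -/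
def IsHorizontalRegularRectangle (A : Bimatroid E F) (S : Finset E) (T : Finset F) : Prop :=
  A.relRank S T = S.card ∧ S.card ≤ T.card

open Classical in
/-- The number of vertical regular rectangles with `k` columns. -/
noncomputable def numVertical [Fintype E] [Fintype F] (A : Bimatroid E F) (k : ℕ) : ℕ :=
  (Finset.univ.filter fun p : Finset E × Finset F =>
    A.IsVerticalRegularRectangle p.1 p.2 ∧ p.2.card = k).card

open Classical in
/-- The number of horizontal regular rectangles with `k` rows. -/
noncomputable def numHorizontal [Fintype E] [Fintype F] (A : Bimatroid E F) (k : ℕ) : ℕ :=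
  (Finset.univ.filter fun p : Finset E × Finset F =>
    A.IsHorizontalRegularRectangle p.1 p.2 ∧ p.1.card = k).card

end Bimatroid

/-- A sequence `a 0, …, a N` of nonnegative reals (extended by `0` beyond `N`) is ultra log-concave
with respect to `N` if it has no internal zeros and `a k / (N choose k)` is log-concave. For `k > N`
both `a k` and `N choose k` vanish and the quotient is read as `0`. -/
structure IsUltraLogConcave (N : ℕ) (a : ℕ → ℝ) : Prop where
  nonneg : ∀ k, 0 ≤ a k
  eq_zero : ∀ k, N < k → a k = 0
  no_internal_zeros : ∀ i k j, i < k → k < j → a i ≠ 0 → a j ≠ 0 → a k ≠ 0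
  ineq : ∀ k, 1 ≤ k →
    a k ^ 2 / (N.choose k : ℝ) ^ 2 ≥
      a (k - 1) / (N.choose (k - 1) : ℝ) * (a (k + 1) / (N.choose (k + 1) : ℝ))

/-! The sets `(E \ I) ∪ J`, for regular minors `(I, J)`, are the bases of a matroid on `E ⊕ F`
(`toMatroid`). A rectangle `(S, T)` is vertical regular exactly when `(E \ S) ∪ T` is independent,
and horizontal regular exactly when `S ∪ (F \ T)` is independent in the dual. Both counts thus
become the number of independent sets meeting a fixed set `W` in `k` elements (`W = F`, resp. `W =
E`), and it suffices to prove `isUltraLogConcave_numIndepMeeting` for an arbitrary matroid on `n`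
elements.

For this, take the homogenized generating polynomial `∑ z₀ ^ (n - |J|) z ^ J` over independent `J`,
with `z₀` indexed by `none`. Setting `z_a = y` on `W` and every other variable, `z₀` included, to
`x` gives a binary form whose coefficient of `x ^ (n - k) y ^ k` is the wanted number. Ultra
log-concavity of the coefficients is the reverse Cauchy–Schwarz inequality for mixed derivatives in
the two directions, so the polynomial must be shown to be Lorentzian.

Its quadratic derivatives are handled by Cauchy–Schwarz over parallel classes of a contraction
(`mixedMatrix_indepWeight_isLorentzian`). The property then passes to mixed derivatives along
positive directions (`mixedMatrix_isLorentzian`) by a spectral argument, `nonpos_on_orthogonal`: the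
hypothesis there says `K ≤ K²` for the normalized matrix `K`, so no eigenvalue lies in `(0, 1)`,
while the Schur test bounds eigenvalues by `1` and a common neighbour makes `1` simple. -/

open Matrix in
/-- A real matrix is Lorentzian if its quadratic form satisfies the reverse Cauchy–Schwarz
inequality against every vector on which it is nonnegative. -/
def Matrix.IsLorentzian {ι : Type*} [Fintype ι] (M : Matrix ι ι ℝ) : Prop :=
  ∀ x y : ι → ℝ, 0 ≤ y ⬝ᵥ M *ᵥ y →
    (x ⬝ᵥ M *ᵥ x) * (y ⬝ᵥ M *ᵥ y) ≤ (x ⬝ᵥ M *ᵥ y) ^ 2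

/-! ### Linear algebra of Lorentzian matrices -/

section LinearAlgebra

open Matrix

variable {ι : Type*} [Fintype ι]

lemma Matrix.IsSymm.dotProduct_mulVec_comm {M : Matrix ι ι ℝ} (hM : M.IsSymm) (x y : ι → ℝ) :
    x ⬝ᵥ M *ᵥ y = y ⬝ᵥ M *ᵥ x := by
  rw [dotProduct_mulVec, ← mulVec_transpose, hM.eq, dotProduct_comm]

/-- The combination `(yᵀMv) x - (xᵀMv) y` is `M`-orthogonal to `v`, so the form is nonpositive on
it. Multiplying the expansion by `yᵀMy` and completing the square gives the claim; `yᵀMv = 0` is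
impossible when `yᵀMy > 0`. -/
lemma Matrix.IsLorentzian.of_nonpos_on_orthogonal {M : Matrix ι ι ℝ} (hM : M.IsSymm) (v : ι → ℝ)
    (h : ∀ x, x ⬝ᵥ M *ᵥ v = 0 → x ⬝ᵥ M *ᵥ x ≤ 0) :
    M.IsLorentzian := by
  have key : ∀ x y : ι → ℝ, (y ⬝ᵥ M *ᵥ v) ^ 2 * (x ⬝ᵥ M *ᵥ x)
      - 2 * (y ⬝ᵥ M *ᵥ v) * (x ⬝ᵥ M *ᵥ v) * (x ⬝ᵥ M *ᵥ y)
      + (x ⬝ᵥ M *ᵥ v) ^ 2 * (y ⬝ᵥ M *ᵥ y) ≤ 0 := by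
    intro x y
    have h0 := h ((y ⬝ᵥ M *ᵥ v) • x - (x ⬝ᵥ M *ᵥ v) • y) (by
      simp only [sub_dotProduct, smul_dotProduct, smul_eq_mul]; ring)
    refine le_trans (le_of_eq ?_) h0
    simp only [sub_dotProduct, smul_dotProduct, smul_eq_mul, mulVec_sub, mulVec_smul,
      dotProduct_sub, dotProduct_smul]
    rw [hM.dotProduct_mulVec_comm y x]
    ring
  intro x y hy
  rcases hy.eq_or_lt with hy | hy
  · rw [← hy, mul_zero]; positivity
  have ha : y ⬝ᵥ M *ᵥ v ≠ 0 := fun ha => absurd (h y ha) (not_le.2 hy)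
  have ha2 : 0 < (y ⬝ᵥ M *ᵥ v) ^ 2 := by positivity
  have hk := key x y
  generalize y ⬝ᵥ M *ᵥ v = a at *
  generalize x ⬝ᵥ M *ᵥ v = b at *
  generalize x ⬝ᵥ M *ᵥ x = A at *
  generalize y ⬝ᵥ M *ᵥ y = C at *
  generalize x ⬝ᵥ M *ᵥ y = B at *
  have h1 : a ^ 2 * (A * C - B ^ 2) ≤ 0 := by
    have := mul_nonpos_of_nonneg_of_nonpos hy.le hk
    nlinarith [sq_nonneg (b * C - a * B)]
  nlinarith

/-- A symmetric matrix whose quadratic form takes a positive value on a vector has a positive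
eigenvalue. -/
lemma Matrix.IsSymm.exists_pos_eigenvector [DecidableEq ι] {M : Matrix ι ι ℝ} (hM : M.IsSymm)
    (x : ι → ℝ) (hx : 0 < x ⬝ᵥ M *ᵥ x) :
    ∃ (μ : ℝ) (z : ι → ℝ), 0 < μ ∧ z ≠ 0 ∧ M *ᵥ z = μ • z := by
  have hH : (-M).IsHermitian := by
    rw [Matrix.IsHermitian, conjTranspose_eq_transpose_of_trivial, transpose_neg, hM.eq]
  have hn : ¬ (-M).PosSemidef := by
    intro h
    have h2 := h.dotProduct_mulVec_nonneg x
    simp only [star_trivial, neg_mulVec, dotProduct_neg] at h2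
    linarith
  rw [hH.posSemidef_iff_eigenvalues_nonneg] at hn
  simp only [Pi.le_def, not_forall, not_le, Pi.zero_apply] at hn
  obtain ⟨i, hi⟩ := hn
  refine ⟨-hH.eigenvalues i, ⇑(hH.eigenvectorBasis i), by linarith, ?_, ?_⟩
  · intro h
    apply hH.eigenvectorBasis.orthonormal.ne_zero i
    ext j
    exact congrFun h j
  · have := hH.mulVec_eigenvectorBasis i
    rw [neg_mulVec] at this
    rw [neg_smul, ← this, neg_neg]

/-- The local-to-global step: a nonnegative symmetric matrix dominated by `M D M`, where `D` is the
diagonal matrix with entries `v i / (M v) i`, is negative semidefinite on the orthogonal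
complement of `v`, provided some index is adjacent to all nonzero rows. -/
lemma Matrix.IsSymm.nonpos_on_orthogonal {M : Matrix ι ι ℝ} (hM : M.IsSymm)
    (h0 : ∀ i j, 0 ≤ M i j) (o : ι) (ho : ∀ i j, M i j ≠ 0 → M o j ≠ 0)
    (v : ι → ℝ) (hv : ∀ i, 0 < v i)
    (hdom : ∀ x, x ⬝ᵥ M *ᵥ x ≤ ∑ i, v i / (M *ᵥ v) i * ((M *ᵥ x) i) ^ 2)
    (x : ι → ℝ) (hx : x ⬝ᵥ M *ᵥ v = 0) : x ⬝ᵥ M *ᵥ x ≤ 0 := by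
  classical
  by_contra! hpos
  have hMv : ∀ i, 0 ≤ (M *ᵥ v) i := fun i =>
    Finset.sum_nonneg fun j _ => mul_nonneg (h0 i j) (hv j).le
  have hrow : ∀ i, (M *ᵥ v) i = 0 → ∀ j, M i j = 0 := by
    intro i hi j
    have := (Finset.sum_eq_zero_iff_of_nonneg
      (fun j _ => mul_nonneg (h0 i j) (hv j).le)).1 hi j (Finset.mem_univ j)
    exact (mul_eq_zero.1 this).resolve_right (hv j).ne'
  -- If `(M v) i = 0`, the quotient reads `0` and `s i = 0`; row and column `i` of `M` then vanish,
  -- so such indices drop out of every sum.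
  set s : ι → ℝ := fun i => √(v i / (M *ᵥ v) i) with hs
  have hs2 : ∀ i, s i ^ 2 = v i / (M *ᵥ v) i := fun i =>
    Real.sq_sqrt (div_nonneg (hv i).le (hMv i))
  have hs0 : ∀ i, s i = 0 → (M *ᵥ v) i = 0 := by
    intro i hi
    have h1 := hs2 i
    rw [hi] at h1
    rcases div_eq_zero_iff.1 (by simpa using h1.symm) with h | h
    · exact absurd h (hv i).ne'
    · exact h
  have hcol : ∀ j, s j = 0 → ∀ i, M i j = 0 := fun j hj i => by
    rw [← hM.apply]; exact hrow j (hs0 j hj) i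
  have hsmv : ∀ i, s i ≠ 0 → s i ^ 2 * (M *ᵥ v) i = v i := by
    intro i hi
    rw [hs2, div_mul_cancel₀]
    intro h
    apply hi
    simp [hs, h]
  set w : ι → ℝ := fun i => v i / s i with hw
  -- the normalized matrix, deflated along its Perron vector `w`
  set K : Matrix ι ι ℝ := fun i j => s i * M i j * s j with hK
  have hKs : K.IsSymm := by
    ext i j
    change s j * M j i * s i = s i * M i j * s j
    rw [hM.apply i j]; ring
  have hKmul : ∀ (z : ι → ℝ) i, (K *ᵥ z) i = s i * (M *ᵥ (fun j => s j * z j)) i := by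
    intro z i
    simp only [mulVec, dotProduct, hK, Finset.mul_sum]
    exact Finset.sum_congr rfl fun j _ => by ring
  have hMcongr : ∀ y z : ι → ℝ, (∀ i, s i ≠ 0 → y i = z i) → M *ᵥ y = M *ᵥ z := by
    intro y z h
    ext i
    refine Finset.sum_congr rfl fun j _ => ?_
    by_cases hj : s j = 0
    · simp [hcol j hj i]
    · simp [h j hj]
  have hKw : K *ᵥ w = w := by
    ext i
    rw [hKmul, hMcongr (fun j => s j * w j) v (fun j hj => by simp only [hw]; field_simp)]
    by_cases hi : s i = 0
    · simp [hw, hi]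
    · simp only [hw]; rw [eq_div_iff hi, ← hsmv i hi]; ring
  have hKquad : ∀ z y : ι → ℝ, z ⬝ᵥ K *ᵥ y
      = (fun j => s j * z j) ⬝ᵥ M *ᵥ (fun j => s j * y j) := by
    intro z y
    simp only [dotProduct, hKmul]
    exact Finset.sum_congr rfl fun j _ => by ring
  set ww := w ⬝ᵥ w with hww
  -- Subtracting the projection onto `w` kills `w`. An eigenvector of `D` with positive eigenvalue
  -- is therefore orthogonal to `w`, hence also an eigenvector of `K`.
  set D : Matrix ι ι ℝ := K - (ww⁻¹) • vecMulVec w w with hD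
  have hDs : D.IsSymm := by
    ext i j
    simp only [hD, transpose_apply, sub_apply, smul_apply, vecMulVec_apply, hKs.apply i j]
    rw [mul_comm (w i)]
  have hDmul : ∀ z, D *ᵥ z = K *ᵥ z - (ww⁻¹ * (w ⬝ᵥ z)) • w := by
    intro z
    ext i
    simp only [hD, sub_mulVec, smul_mulVec, Pi.sub_apply, Pi.smul_apply, smul_eq_mul,
      vecMulVec_mulVec, op_smul_eq_smul]
    ring
  have hwpos : 0 < ww ∨ w = 0 := by
    rcases eq_or_ne w 0 with h | h
    · exact Or.inr h
    · left
      have : 0 ≤ w ⬝ᵥ w := Finset.sum_nonneg fun i _ => mul_self_nonneg (w i)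
      exact lt_of_le_of_ne this (fun h' => h (dotProduct_self_eq_zero.1 h'.symm))
  have hDw : D *ᵥ w = 0 := by
    rw [hDmul, hKw]
    rcases hwpos with h | h
    · rw [← hww, inv_mul_cancel₀ h.ne', one_smul, sub_self]
    · simp [h]
  set x' : ι → ℝ := fun i => x i / s i with hx'
  have hx's : ∀ i, s i ≠ 0 → s i * x' i = x i := fun i hi => by simp only [hx']; field_simp
  have hquad' : ∀ y z : ι → ℝ, (∀ i, s i ≠ 0 → y i = z i) → y ⬝ᵥ M *ᵥ y = z ⬝ᵥ M *ᵥ z := by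
    intro y z h
    rw [hMcongr y z h, hM.dotProduct_mulVec_comm, hMcongr y z h]
  have hKx : x' ⬝ᵥ K *ᵥ x' = x ⬝ᵥ M *ᵥ x := by
    rw [hKquad]; exact hquad' _ _ hx's
  have hwx : w ⬝ᵥ x' = 0 := by
    rw [← hx, dotProduct_comm]
    refine Finset.sum_congr rfl fun i _ => ?_
    by_cases hi : s i = 0
    · simp [hs0 i hi, hw, hi]
    · simp only [hw, hx']
      rw [← hsmv i hi]
      field_simp
  have hDx : 0 < x' ⬝ᵥ D *ᵥ x' := by
    rw [hDmul, hwx, mul_zero, zero_smul, sub_zero, hKx]; exact hpos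
  obtain ⟨μ, z, hμ, hz, hDz⟩ := hDs.exists_pos_eigenvector x' hDx
  have hwz : w ⬝ᵥ z = 0 := by
    have h1 : w ⬝ᵥ D *ᵥ z = μ * (w ⬝ᵥ z) := by rw [hDz, dotProduct_smul, smul_eq_mul]
    rw [hDs.dotProduct_mulVec_comm, hDw, dotProduct_zero] at h1
    exact (mul_eq_zero.1 h1.symm).resolve_left hμ.ne'
  have hKz : K *ᵥ z = μ • z := by
    rw [← hDz, hDmul, hwz, mul_zero, zero_smul, sub_zero]
  have hzz : 0 < z ⬝ᵥ z :=
    lt_of_le_of_ne (Finset.sum_nonneg fun i _ => mul_self_nonneg (z i))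
      (fun h' => hz (dotProduct_self_eq_zero.1 h'.symm))
  have hz0 : ∀ i, s i = 0 → z i = 0 := by
    intro i hi
    have h1 := congrFun hKz i
    rw [hKmul, hi, zero_mul] at h1
    exact (mul_eq_zero.1 h1.symm).resolve_left hμ.ne'
  have hquadz : z ⬝ᵥ K *ᵥ z = μ * (z ⬝ᵥ z) := by rw [hKz, dotProduct_smul, smul_eq_mul]
  -- the eigenvalue is at least one
  have hμ1 : 1 ≤ μ := by
    have h1 := hdom (fun j => s j * z j)
    rw [← hKquad, hquadz] at h1
    have h2 : ∑ i, v i / (M *ᵥ v) i * ((M *ᵥ fun j => s j * z j) i) ^ 2 = μ ^ 2 * (z ⬝ᵥ z) := by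
      simp only [dotProduct, Finset.mul_sum]
      refine Finset.sum_congr rfl fun i _ => ?_
      rw [← hs2, ← mul_pow, ← hKmul, hKz, Pi.smul_apply, smul_eq_mul]; ring
    rw [h2] at h1
    have h3 : μ ≤ μ ^ 2 := le_of_mul_le_mul_right h1 hzz
    nlinarith
  -- the Schur test
  set y : ι → ℝ := fun i => s i * z i / v i with hy
  have hvy : ∀ i, v i * y i = s i * z i := fun i => by
    simp only [hy]; rw [mul_div_cancel₀ _ (hv i).ne']
  -- The summands are nonnegative, so this identity forces `μ ≤ 1`; with `1 ≤ μ` the whole sum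
  -- vanishes.
  have hS : ∑ i, ∑ j, M i j * v i * v j * (y i - y j) ^ 2 = 2 * (1 - μ) * (z ⬝ᵥ z) := by
    have e1 : ∑ i, ∑ j, M i j * v i * v j * y i ^ 2 = z ⬝ᵥ z := by
      refine Finset.sum_congr rfl fun i _ => ?_
      have : ∑ j, M i j * v i * v j * y i ^ 2 = v i * y i ^ 2 * (M *ᵥ v) i := by
        simp only [mulVec, dotProduct, Finset.mul_sum]
        exact Finset.sum_congr rfl fun j _ => by ring
      rw [this]
      by_cases hi : s i = 0
      · simp [hz0 i hi, hs0 i hi]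
      · have h1 := hvy i
        have h2 := hsmv i hi
        have h3 : v i * (v i * y i ^ 2 * (M *ᵥ v) i) = v i * (z i * z i) := by
          calc _ = (v i * y i) ^ 2 * (M *ᵥ v) i := by ring
            _ = (s i ^ 2 * (M *ᵥ v) i) * (z i * z i) := by rw [h1]; ring
            _ = _ := by rw [h2]
        exact mul_left_cancel₀ (hv i).ne' h3
    have e2 : ∑ i, ∑ j, M i j * v i * v j * y j ^ 2 = z ⬝ᵥ z := by
      rw [Finset.sum_comm, ← e1]
      refine Finset.sum_congr rfl fun i _ => Finset.sum_congr rfl fun j _ => ?_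
      rw [hM.apply]; ring
    have e3 : ∑ i, ∑ j, M i j * v i * v j * (y i * y j) = μ * (z ⬝ᵥ z) := by
      rw [← hquadz, hKquad]
      simp only [dotProduct, mulVec, Finset.mul_sum]
      refine Finset.sum_congr rfl fun i _ => Finset.sum_congr rfl fun j _ => ?_
      rw [← hvy, ← hvy]; ring
    have : ∀ i j, M i j * v i * v j * (y i - y j) ^ 2 = M i j * v i * v j * y i ^ 2
        + M i j * v i * v j * y j ^ 2 - 2 * (M i j * v i * v j * (y i * y j)) := by
      intro i j; ring
    simp only [this, Finset.sum_sub_distrib, Finset.sum_add_distrib, ← Finset.mul_sum, e1, e2, e3]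
    ring
  have hterm : ∀ i j, 0 ≤ M i j * v i * v j * (y i - y j) ^ 2 := fun i j =>
    mul_nonneg (mul_nonneg (mul_nonneg (h0 i j) (hv i).le) (hv j).le) (sq_nonneg _)
  have hSz : ∑ i, ∑ j, M i j * v i * v j * (y i - y j) ^ 2 = 0 := by
    refine le_antisymm ?_ (Finset.sum_nonneg fun i _ => Finset.sum_nonneg fun j _ => hterm i j)
    rw [hS]
    nlinarith
  -- Only the vanishing summands of row `o` are needed, since `o` is adjacent to every index with a
  -- nonzero row. Constancy of `y` makes `z` a multiple of `w`, against orthogonality.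
  have hyo : ∀ j, s j ≠ 0 → y j = y o := by
    intro j hj
    have hex : ∃ i, M i j ≠ 0 := by
      by_contra! hne
      apply hj
      have : (M *ᵥ v) j = 0 :=
        Finset.sum_eq_zero fun i _ => by
          change M j i * v i = 0
          rw [hM.apply i j, hne i, zero_mul]
      simp [hs, this]
    obtain ⟨i, hi⟩ := hex
    have h1 := (Finset.sum_eq_zero_iff_of_nonneg (fun i _ =>
      Finset.sum_nonneg fun j _ => hterm i j)).1 hSz o (Finset.mem_univ o)
    have h2 := (Finset.sum_eq_zero_iff_of_nonneg (fun j _ => hterm o j)).1 h1 j (Finset.mem_univ j)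
    have h3 := ho i j hi
    have h4 := (hv o).ne'
    have h5 := (hv j).ne'
    have : (y o - y j) ^ 2 = 0 := by simpa [h3, h4, h5] using h2
    linarith [pow_eq_zero_iff (two_ne_zero) |>.1 this]
  have hzw : z = y o • w := by
    ext i
    by_cases hi : s i = 0
    · simp [hz0 i hi, hw, hi]
    · have h1 := hvy i
      rw [hyo i hi] at h1
      simp only [Pi.smul_apply, smul_eq_mul, hw]
      field_simp
      linarith
  have : z ⬝ᵥ z = 0 := by
    nth_rewrite 1 [hzw]
    rw [smul_dotProduct, hwz, smul_zero]
  linarith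

end LinearAlgebra

/-! ### Mixed derivatives and the passage from quadratic derivatives to all mixed ones -/

section MixedForm

open Matrix

variable {ι : Type*} [Fintype ι]

/-- The iterated directional derivative along a list of vectors of the polynomial whose iterated
partial derivatives are the values of `c`. -/
def mixedForm (c : Multiset ι → ℝ) : List (ι → ℝ) → Multiset ι → ℝ
  | [], l => c l
  | v :: vs, l => ∑ i, v i * mixedForm c vs (i ::ₘ l)

/-- The Hessian of an iterated directional derivative. -/
def mixedMatrix (c : Multiset ι → ℝ) (vs : List (ι → ℝ)) (l : Multiset ι) : Matrix ι ι ℝ :=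
  fun i j => mixedForm c vs (i ::ₘ j ::ₘ l)

lemma mixedMatrix_isSymm (c : Multiset ι → ℝ) (vs : List (ι → ℝ)) (l : Multiset ι) :
    (mixedMatrix c vs l).IsSymm := by
  ext i j
  change mixedForm c vs (j ::ₘ i ::ₘ l) = mixedForm c vs (i ::ₘ j ::ₘ l)
  rw [Multiset.cons_swap]

lemma mixedForm_nonneg {c : Multiset ι → ℝ} (hc : ∀ l, 0 ≤ c l) :
    ∀ (vs : List (ι → ℝ)) (_ : ∀ v ∈ vs, ∀ i, 0 < v i) (l : Multiset ι), 0 ≤ mixedForm c vs l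
  | [], _, l => hc l
  | v :: vs, hvs, _ => Finset.sum_nonneg fun i _ =>
      mul_nonneg (hvs v List.mem_cons_self i).le
        (mixedForm_nonneg hc vs (fun u hu => hvs u (List.mem_cons_of_mem _ hu)) _)

/-- No cancellation occurs along positive directions, so the domination of all indices by `o`
survives differentiation. This supplies the common neighbour required by `nonpos_on_orthogonal`. -/
lemma mixedForm_ne_zero_of_cons {c : Multiset ι → ℝ} (hc : ∀ l, 0 ≤ c l) {o : ι}
    (ho : ∀ i l, c (i ::ₘ l) ≠ 0 → c (o ::ₘ l) ≠ 0) :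
    ∀ (vs : List (ι → ℝ)) (_ : ∀ v ∈ vs, ∀ i, 0 < v i) (i : ι) (l : Multiset ι),
      mixedForm c vs (i ::ₘ l) ≠ 0 → mixedForm c vs (o ::ₘ l) ≠ 0
  | [], _, i, _ => ho i _
  | v :: vs, hvs, i, l => by
    intro h
    have hvs' : ∀ u ∈ vs, ∀ i, 0 < u i := fun u hu => hvs u (List.mem_cons_of_mem _ hu)
    obtain ⟨k, -, hk⟩ := Finset.exists_ne_zero_of_sum_ne_zero h
    have hk' := right_ne_zero_of_mul hk
    rw [Multiset.cons_swap] at hk'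
    have h1 := mixedForm_ne_zero_of_cons hc ho vs hvs' i _ hk'
    rw [Multiset.cons_swap] at h1
    have hv := hvs v List.mem_cons_self
    have h2 : 0 < ∑ i, v i * mixedForm c vs (i ::ₘ o ::ₘ l) :=
      Finset.sum_pos' (fun i _ => mul_nonneg (hv i).le (mixedForm_nonneg hc vs hvs' _))
        ⟨k, Finset.mem_univ k, mul_pos (hv k)
          (lt_of_le_of_ne (mixedForm_nonneg hc vs hvs' _) h1.symm)⟩
    exact h2.ne'

/-- With the next lemma, this expresses a Hessian `H` differentiated along `v` through the Hessians
`H_i` of the partial derivatives: `(H x) i = xᵀ H_i v` and `xᵀ H x = ∑ v i (xᵀ H_i x)`. -/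
lemma mixedMatrix_cons_mulVec (c : Multiset ι → ℝ) (v : ι → ℝ) (vs : List (ι → ℝ))
    (l : Multiset ι) (x : ι → ℝ) (i : ι) :
    (mixedMatrix c (v :: vs) l *ᵥ x) i = x ⬝ᵥ mixedMatrix c vs (i ::ₘ l) *ᵥ v := by
  simp only [mulVec, dotProduct, mixedMatrix, mixedForm]
  refine Finset.sum_congr rfl fun j _ => ?_
  rw [mul_comm]
  congr 1
  refine Finset.sum_congr rfl fun k _ => ?_
  rw [mul_comm, Multiset.cons_swap k i, Multiset.cons_swap k j, Multiset.cons_swap i j,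
    Multiset.cons_swap i k]

lemma mixedMatrix_cons_quadratic (c : Multiset ι → ℝ) (v : ι → ℝ) (vs : List (ι → ℝ))
    (l : Multiset ι) (x : ι → ℝ) :
    x ⬝ᵥ mixedMatrix c (v :: vs) l *ᵥ x
      = ∑ i, v i * (x ⬝ᵥ mixedMatrix c vs (i ::ₘ l) *ᵥ x) := by
  simp only [mulVec, dotProduct, mixedMatrix, mixedForm, Finset.mul_sum, Finset.sum_mul]
  rw [Finset.sum_comm_cycle]
  refine Finset.sum_congr rfl fun k _ => ?_
  rw [Finset.sum_comm]
  refine Finset.sum_congr rfl fun i _ => Finset.sum_congr rfl fun j _ => ?_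
  rw [Multiset.cons_swap j i, Multiset.cons_swap k i, Multiset.cons_swap k j]
  ring

lemma dotProduct_mixedMatrix_mulVec (c : Multiset ι → ℝ) (x y : ι → ℝ) (vs : List (ι → ℝ))
    (l : Multiset ι) :
    x ⬝ᵥ mixedMatrix c vs l *ᵥ y = mixedForm c (x :: y :: vs) l := by
  simp only [mulVec, dotProduct, mixedMatrix, mixedForm]
  refine Finset.sum_congr rfl fun i _ => ?_
  congr 1
  refine Finset.sum_congr rfl fun j _ => ?_
  rw [mul_comm, Multiset.cons_swap]

/-- If all the iterated partial derivatives of order `n - 2` are Lorentzian quadratic forms, then so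
are all the mixed derivatives of order `n - 2` along positive directions. -/
theorem mixedMatrix_isLorentzian {c : Multiset ι → ℝ} (hc : ∀ l, 0 ≤ c l) {o : ι}
    (ho : ∀ i l, c (i ::ₘ l) ≠ 0 → c (o ::ₘ l) ≠ 0) (n : ℕ)
    (hbase : ∀ l : Multiset ι, l.card + 2 = n → (mixedMatrix c [] l).IsLorentzian) :
    ∀ (vs : List (ι → ℝ)) (_ : ∀ v ∈ vs, ∀ i, 0 < v i) (l : Multiset ι),
      l.card + vs.length + 2 = n → (mixedMatrix c vs l).IsLorentzian
  | [], _, l, hl => hbase l hl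
  | v :: vs, hvs, l, hl => by
    have hvs' : ∀ u ∈ vs, ∀ i, 0 < u i := fun u hu => hvs u (List.mem_cons_of_mem _ hu)
    have hv := hvs v List.mem_cons_self
    have ih : ∀ i, (mixedMatrix c vs (i ::ₘ l)).IsLorentzian := fun i =>
      mixedMatrix_isLorentzian hc ho n hbase vs hvs' (i ::ₘ l) (by
        simp only [Multiset.card_cons, List.length_cons] at hl ⊢; omega)
    refine Matrix.IsLorentzian.of_nonpos_on_orthogonal (mixedMatrix_isSymm c _ l) v ?_
    refine (mixedMatrix_isSymm c _ l).nonpos_on_orthogonal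
      (fun i j => mixedForm_nonneg hc _ hvs _) o
      (fun i j h => mixedForm_ne_zero_of_cons hc ho _ hvs i _ h) v hv ?_
    intro x
    rw [mixedMatrix_cons_quadratic]
    refine Finset.sum_le_sum fun i _ => ?_
    -- Since `(H v) i = vᵀ H_i v`, the domination holds term by term: it is the inductive reverse
    -- Cauchy–Schwarz inequality for `H_i` against `v`.
    rw [mixedMatrix_cons_mulVec, mixedMatrix_cons_mulVec, div_mul_eq_mul_div, mul_div_assoc]
    refine mul_le_mul_of_nonneg_left ?_ (hv i).le
    have hterm : ∀ j k, 0 ≤ mixedMatrix c vs (i ::ₘ l) j k * v k := fun j k =>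
      mul_nonneg (mixedForm_nonneg hc _ hvs' _) (hv k).le
    have hnn : ∀ j, 0 ≤ (mixedMatrix c vs (i ::ₘ l) *ᵥ v) j := fun j =>
      Finset.sum_nonneg fun k _ => hterm j k
    have h0 : 0 ≤ v ⬝ᵥ mixedMatrix c vs (i ::ₘ l) *ᵥ v :=
      Finset.sum_nonneg fun j _ => mul_nonneg (hv j).le (hnn j)
    rcases h0.eq_or_lt with h | h
    · rw [← h, div_zero]
      -- A nonnegative matrix whose form vanishes on a positive vector is zero.
      have hz : mixedMatrix c vs (i ::ₘ l) = 0 := by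
        ext j k
        have h1 := (Finset.sum_eq_zero_iff_of_nonneg
          (fun j _ => mul_nonneg (hv j).le (hnn j))).1 h.symm j (Finset.mem_univ j)
        have h2 := (mul_eq_zero.1 h1).resolve_left (hv j).ne'
        have h3 := (Finset.sum_eq_zero_iff_of_nonneg (fun k _ => hterm j k)).1 h2 k
          (Finset.mem_univ k)
        exact (mul_eq_zero.1 h3).resolve_right (hv k).ne'
      simp [hz]
    · rw [le_div_iff₀ h]
      exact ih i x v h0

lemma continuous_mixedForm {β : Type*} (c : Multiset ι → ℝ) (v : ℝ → β → ι → ℝ)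
    (hv : ∀ b i, Continuous fun ε => v ε b i) :
    ∀ (bs : List β) (l : Multiset ι), Continuous fun ε => mixedForm c (bs.map (v ε)) l
  | [], _ => continuous_const
  | b :: bs, l => by
    simp only [List.map_cons, mixedForm]
    exact continuous_finsetSum _ fun i _ => (hv b i).mul (continuous_mixedForm c v hv bs _)

end MixedForm

/-! ### Quadratic derivatives of the independent set polynomial -/

/-- The double sum is the sum of squares of the fibre sums of `κ`; Cauchy–Schwarz applies, as there
are at most `s.card` nonempty fibres. -/
lemma sq_sum_le_card_mul_sum_fiber {α β : Type*} [DecidableEq β] (s : Finset α) (κ : α → β)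
    (x : α → ℝ) :
    (∑ a ∈ s, x a) ^ 2
      ≤ (s.card : ℝ) * ∑ a ∈ s, ∑ b ∈ s, if κ a = κ b then x a * x b else 0 := by
  have hmaps : ∀ a ∈ s, κ a ∈ s.image κ := fun a ha => Finset.mem_image_of_mem κ ha
  set t : β → ℝ := fun c => ∑ a ∈ s with κ a = c, x a with ht
  have h1 : ∑ a ∈ s, x a = ∑ c ∈ s.image κ, t c := (Finset.sum_fiberwise_of_maps_to hmaps x).symm
  have h2 : (∑ a ∈ s, ∑ b ∈ s, if κ a = κ b then x a * x b else 0)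
      = ∑ c ∈ s.image κ, t c ^ 2 := by
    rw [← Finset.sum_fiberwise_of_maps_to hmaps]
    refine Finset.sum_congr rfl fun c _ => ?_
    rw [sq, ht, Finset.sum_mul_sum]
    refine Finset.sum_congr rfl fun a ha => ?_
    rw [Finset.sum_filter]
    refine Finset.sum_congr rfl fun b _ => ?_
    rw [(Finset.mem_filter.1 ha).2]
    simp only [eq_comm]
  rw [h1, h2]
  refine sq_sum_le_card_mul_sum_sq.trans ?_
  refine mul_le_mul_of_nonneg_right ?_ (Finset.sum_nonneg fun c _ => sq_nonneg _)
  exact_mod_cast Finset.card_image_le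

namespace Matroid

/-- In the contraction by `I`, two nonloops are dependent exactly when they are parallel, that is,
span the same flat together with `I`. -/
lemma indep_insert_insert_iff {α : Type*} {M : Matroid α} {I : Set α} {a b : α} (hab : a ≠ b)
    (ha : a ∉ I) :
    M.Indep (insert a (insert b I)) ↔ M.Indep (insert a I) ∧ M.Indep (insert b I) ∧
      M.closure (insert a I) ≠ M.closure (insert b I) := by
  have ha' : a ∉ insert b I := by simp [hab, ha]
  constructor
  · intro h
    refine ⟨h.subset (Set.insert_subset_insert (Set.subset_insert _ _)),
      h.subset (Set.subset_insert _ _), fun hcl => ?_⟩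
    have h1 : a ∈ M.closure (insert b I) := hcl ▸
      M.mem_closure_of_mem' (Set.mem_insert a I) (h.subset_ground (Set.mem_insert _ _))
    exact (((h.subset (Set.subset_insert _ _)).mem_closure_iff_of_notMem ha').1 h1).not_indep h
  · rintro ⟨h1, h2, h3⟩
    by_contra h
    have haE := h1.subset_ground (Set.mem_insert a I)
    have hI := h1.subset (Set.subset_insert a I)
    apply h3
    refine closure_insert_congr ⟨?_, fun hcl => ?_⟩
    · rw [h2.mem_closure_iff_of_notMem ha', dep_iff]
      exact ⟨h, Set.insert_subset haE h2.subset_ground⟩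
    · exact ((hI.mem_closure_iff_of_notMem ha).1 hcl).not_indep h1

variable {α : Type*} [DecidableEq α]

/-- The elements of `α` occurring in a multiset of elements of `Option α` are pairwise distinct and
form an independent set. -/
def IndepMultiset (M : Matroid α) (l : Multiset (Option α)) : Prop :=
  (∀ a, l.count (some a) ≤ 1) ∧ M.Indep {a | some a ∈ l}

open Classical in
/-- The iterated partial derivatives, of top order, of the homogenized generating polynomial of the
independent sets of a matroid. -/
noncomputable def indepWeight (M : Matroid α) (l : Multiset (Option α)) : ℝ :=
  if M.IndepMultiset l then ((l.count none).factorial : ℝ) else 0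

lemma indepWeight_nonneg (M : Matroid α) (l : Multiset (Option α)) : 0 ≤ M.indepWeight l := by
  unfold indepWeight
  split_ifs <;> positivity

lemma indepWeight_ne_zero_iff (M : Matroid α) (l : Multiset (Option α)) :
    M.indepWeight l ≠ 0 ↔ M.IndepMultiset l := by
  unfold indepWeight
  split_ifs with h <;> simp [h, Nat.factorial_ne_zero]

lemma indepMultiset_none_cons (M : Matroid α) (l : Multiset (Option α)) :
    M.IndepMultiset (none ::ₘ l) ↔ M.IndepMultiset l := by
  simp [IndepMultiset]

lemma indepMultiset_some_cons (M : Matroid α) (l : Multiset (Option α)) (a : α) :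
    M.IndepMultiset (some a ::ₘ l) ↔
      M.IndepMultiset l ∧ some a ∉ l ∧ M.Indep (insert a {b | some b ∈ l}) := by
  have hset : {b | some b ∈ some a ::ₘ l} = insert a {b | some b ∈ l} := by
    ext b; simp
  unfold IndepMultiset
  rw [hset]
  constructor
  · rintro ⟨h1, h2⟩
    refine ⟨⟨fun b => (Multiset.count_le_of_le _ (Multiset.le_cons_self l _)).trans (h1 b),
      h2.subset (Set.subset_insert _ _)⟩, ?_, h2⟩
    have := h1 a
    rw [Multiset.count_cons_self] at this
    exact Multiset.count_eq_zero.1 (by omega)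
  · rintro ⟨⟨h1, -⟩, h2, h3⟩
    refine ⟨fun b => ?_, h3⟩
    rw [Multiset.count_cons]
    split_ifs with h
    · rw [Option.some.injEq] at h
      subst h
      rw [Multiset.count_eq_zero.2 h2]
    · exact h1 b

lemma IndepMultiset.of_cons {M : Matroid α} {i : Option α} {l : Multiset (Option α)}
    (h : M.IndepMultiset (i ::ₘ l)) : M.IndepMultiset l := by
  cases i with
  | none => exact (M.indepMultiset_none_cons l).1 h
  | some a => exact ((M.indepMultiset_some_cons l a).1 h).1

variable [Fintype α]

open Classical in
lemma IndepMultiset.card_eq {M : Matroid α} {l : Multiset (Option α)} (h : M.IndepMultiset l) :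
    l.card = l.count none + (Finset.univ.filter fun a => some a ∈ l).card := by
  rw [← Multiset.sum_count_eq_card (s := Finset.univ) (fun _ _ => Finset.mem_univ _),
    Fintype.sum_option, Finset.card_filter]
  congr 1
  refine Finset.sum_congr rfl fun a _ => ?_
  split_ifs with ha
  · exact le_antisymm (h.1 a) (Multiset.one_le_count_iff_mem.2 ha)
  · exact Multiset.count_eq_zero.2 ha

open Matrix in
/-- The second order derivatives of the homogenized generating polynomial of the independent sets of
a matroid are Lorentzian. -/
theorem mixedMatrix_indepWeight_isLorentzian (M : Matroid α) (l : Multiset (Option α))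
    (hl : l.card + 2 = Fintype.card α) : (mixedMatrix M.indepWeight [] l).IsLorentzian := by
  classical
  by_cases hind : M.IndepMultiset l
  swap
  · have hz : mixedMatrix M.indepWeight [] l = 0 := by
      ext i j
      by_contra h
      exact hind ((M.indepWeight_ne_zero_iff _).1 h).of_cons.of_cons
    intro x y _
    simp [hz]
  set I : Set α := {a | some a ∈ l} with hI
  set r := l.count none with hr
  -- `L` consists of the nonloops of the contraction by `I`, and `κ` labels their parallel classes.
  set L : Finset α := Finset.univ.filter fun a => some a ∉ l ∧ M.Indep (insert a I) with hL
  set κ : α → Set α := fun a => M.closure (insert a I) with hκ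
  have e00 : mixedMatrix M.indepWeight [] l none none = (r + 2).factorial := by
    have : M.IndepMultiset (none ::ₘ none ::ₘ l) := by simpa only [indepMultiset_none_cons]
    simp [mixedMatrix, mixedForm, indepWeight, this, hr]
  have e01 : ∀ a, mixedMatrix M.indepWeight [] l none (some a)
      = if a ∈ L then ((r + 1).factorial : ℝ) else 0 := by
    intro a
    have : M.IndepMultiset (none ::ₘ some a ::ₘ l) ↔ a ∈ L := by
      rw [indepMultiset_none_cons, indepMultiset_some_cons]
      simp [hL, hind, hI]
    simp only [mixedMatrix, mixedForm, indepWeight, this]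
    simp [hr]
  have e11 : ∀ a b, mixedMatrix M.indepWeight [] l (some a) (some b)
      = if a ∈ L ∧ b ∈ L ∧ κ a ≠ κ b then (r.factorial : ℝ) else 0 := by
    intro a b
    have : M.IndepMultiset (some a ::ₘ some b ::ₘ l) ↔ a ∈ L ∧ b ∈ L ∧ κ a ≠ κ b := by
      rw [indepMultiset_some_cons, indepMultiset_some_cons]
      have hset : {c | some c ∈ some b ::ₘ l} = insert b I := by ext c; simp [hI]
      rw [hset]
      simp only [hL, Finset.mem_filter, Finset.mem_univ, true_and, hind, Multiset.mem_cons,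
        Option.some.injEq, not_or]
      constructor
      · rintro ⟨⟨hb, hb'⟩, ⟨hab, ha⟩, h⟩
        have := (indep_insert_insert_iff hab ha).1 h
        exact ⟨⟨ha, this.1⟩, ⟨hb, this.2.1⟩, this.2.2⟩
      · rintro ⟨⟨ha, ha'⟩, ⟨hb, hb'⟩, h⟩
        have hab : a ≠ b := fun hab => h (by rw [hab])
        exact ⟨⟨hb, hb'⟩, ⟨hab, ha⟩, (indep_insert_insert_iff hab ha).2 ⟨ha', hb', h⟩⟩
    simp only [mixedMatrix, mixedForm, indepWeight, this]
    simp [hr]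
  have hsymm := mixedMatrix_isSymm M.indepWeight [] l
  -- `L` avoids `I`, and `|I| = l.card - r = n - 2 - r`. This is where the exponent `n - |J|` of
  -- `z₀` matters.
  have hcard : L.card ≤ r + 2 := by
    have h1 := hind.card_eq
    have h2 : L.card + (Finset.univ.filter fun a => some a ∈ l).card ≤ Fintype.card α := by
      rw [← Finset.card_union_of_disjoint]
      · exact Finset.card_le_univ _
      · rw [Finset.disjoint_left]
        intro a ha hb
        exact (Finset.mem_filter.1 ha).2.1 (Finset.mem_filter.1 hb).2
    omega
  refine Matrix.IsLorentzian.of_nonpos_on_orthogonal hsymm (Pi.single none 1) fun x hx => ?_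
  set s := ∑ a ∈ L, x (some a) with hs
  set P := ∑ a ∈ L, ∑ b ∈ L, if κ a = κ b then x (some a) * x (some b) else 0 with hP
  have hP0 : s ^ 2 ≤ (r + 2) * P := by
    have h1 := sq_sum_le_card_mul_sum_fiber L κ (fun a => x (some a))
    have h2 : (L.card : ℝ) ≤ r + 2 := by exact_mod_cast hcard
    rcases le_or_gt 0 P with h | h
    · exact h1.trans (mul_le_mul_of_nonneg_right h2 h)
    · have hL0 : (L.card : ℝ) * P ≤ 0 := mul_nonpos_of_nonneg_of_nonpos (by positivity) h.le
      rcases Nat.eq_zero_or_pos L.card with h0 | h0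
      · have : P = 0 := by rw [hP, Finset.card_eq_zero.1 h0]; simp
        linarith
      · have : (L.card : ℝ) * P < 0 := mul_neg_of_pos_of_neg (by exact_mod_cast h0) h
        have := sq_nonneg s
        linarith
  have hxv : (r + 2) * x none + s = 0 := by
    have h1 : x ⬝ᵥ mixedMatrix M.indepWeight [] l *ᵥ Pi.single none 1
        = (r + 1).factorial * ((r + 2) * x none + s) := by
      simp only [dotProduct, mulVec_single_one, col_apply, Fintype.sum_option]
      rw [e00, Finset.sum_congr rfl fun a _ => by rw [← hsymm.apply, e01]]
      simp only [mul_ite, mul_zero, Finset.sum_ite_mem, Finset.univ_inter, ← Finset.sum_mul]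
      rw [Nat.factorial_succ (r + 1)]
      push_cast
      ring
    rw [hx] at h1
    exact (mul_eq_zero.1 h1.symm).resolve_left (by positivity)
  have hxx : x ⬝ᵥ mixedMatrix M.indepWeight [] l *ᵥ x
      = r.factorial * ((r + 2) * (r + 1) * x none ^ 2 + 2 * (r + 1) * x none * s
        + (s ^ 2 - P)) := by
    have h11 : ∑ a, x (some a) * ∑ b, mixedMatrix M.indepWeight [] l (some a) (some b) * x (some b)
        = r.factorial * (s ^ 2 - P) := by
      have : ∀ a b, mixedMatrix M.indepWeight [] l (some a) (some b) * x (some b)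
          = if a ∈ L then (if b ∈ L then r.factorial * (x (some b)
            - if κ a = κ b then x (some b) else 0) else 0) else 0 := by
        intro a b
        rw [e11]
        by_cases ha : a ∈ L <;> by_cases hb : b ∈ L <;> by_cases h : κ a = κ b <;> simp [ha, hb, h]
      simp only [this]
      have h2 : ∀ a, x (some a) * ∑ b, (if a ∈ L then (if b ∈ L then r.factorial * (x (some b)
            - if κ a = κ b then x (some b) else 0) else 0) else 0)
          = if a ∈ L then r.factorial * (x (some a) * s - ∑ b ∈ L, if κ a = κ b then
              x (some a) * x (some b) else 0) else 0 := by
        intro a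
        split_ifs with ha
        · rw [Finset.sum_ite_mem, Finset.univ_inter, ← Finset.mul_sum, Finset.sum_sub_distrib,
            ← hs, mul_left_comm, mul_sub]
          congr 2
          rw [Finset.mul_sum]
          exact Finset.sum_congr rfl fun b _ => by split_ifs <;> simp
        · simp
      rw [Finset.sum_congr rfl fun a _ => h2 a, Finset.sum_ite_mem, Finset.univ_inter,
        ← Finset.mul_sum, Finset.sum_sub_distrib, ← Finset.sum_mul, ← hs, sq]
    have h01 : ∑ b, mixedMatrix M.indepWeight [] l none (some b) * x (some b)
        = (r + 1).factorial * s := by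
      simp only [e01, ite_mul, zero_mul, Finset.sum_ite_mem, Finset.univ_inter, ← Finset.mul_sum]
      rw [hs]
    have h10 : ∑ a, x (some a) * mixedMatrix M.indepWeight [] l (some a) none
        = (r + 1).factorial * s := by
      rw [← h01]
      exact Finset.sum_congr rfl fun a _ => by rw [← hsymm.apply, mul_comm]
    simp only [dotProduct, mulVec, Fintype.sum_option, mul_add, Finset.sum_add_distrib]
    rw [h11, h01, e00]
    have : ∑ a, x (some a) * (mixedMatrix M.indepWeight [] l (some a) none * x none)
        = (r + 1).factorial * s * x none := by
      rw [← h10, Finset.sum_mul]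
      exact Finset.sum_congr rfl fun a _ => by ring
    rw [this, Nat.factorial_succ (r + 1), Nat.factorial_succ r]
    push_cast
    ring
  rw [hxx]
  refine mul_nonpos_of_nonneg_of_nonpos (by positivity) ?_
  -- On the orthogonal complement the form becomes `r! ((r + 2) x₀² - P)` with `x₀ = x none`, and
  -- the fibre inequality says `P ≥ s² / (r + 2) = (r + 2) x₀²`.
  have hs' : s = -((r + 2) * x none) := by linarith
  have hr0 : (0 : ℝ) < r + 2 := by positivity
  rw [hs'] at hP0 ⊢
  have : (r + 2) * x none ^ 2 ≤ P := by
    refine le_of_mul_le_mul_left (le_trans (le_of_eq ?_) hP0) hr0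
    ring
  nlinarith

end Matroid

/-! ### Restriction of the polynomial to the plane of two variables -/

namespace Matroid

section

variable {α : Type*} [Fintype α]

open Classical in
/-- The independent sets of a matroid on a finite type. -/
noncomputable def indepFinsets (M : Matroid α) : Finset (Finset α) :=
  Finset.univ.filter fun J => M.Indep (J : Set α)

lemma mem_indepFinsets {M : Matroid α} {J : Finset α} :
    J ∈ M.indepFinsets ↔ M.Indep (J : Set α) := by
  simp [indepFinsets]

end

variable {α : Type*} [DecidableEq α]

/-- The indicator vector of `W` (for `true`), or of its complement in `Option α` (for `false`). -/
def sideVector (W : Finset α) : Bool → Option α → ℝ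
  | true, none => 0
  | true, some a => if a ∈ W then 1 else 0
  | false, none => 1
  | false, some a => if a ∈ W then 0 else 1

/-- The elements of `α` occurring in a multiset of elements of `Option α` are pairwise distinct and
belong to `J`. -/
def FitsIn (J : Finset α) (l : Multiset (Option α)) : Prop :=
  ∀ a, l.count (some a) ≤ if a ∈ J then 1 else 0

noncomputable instance (J : Finset α) (l : Multiset (Option α)) : Decidable (FitsIn J l) :=
  Classical.propDecidable _

/-- Up to the factor `p! q!`, the coefficient of `x ^ p y ^ q`, with `p + q + l.card = n`, in the
restriction of the partial derivative along `l` of the monomial `z₀ ^ (n - |J|) z ^ J` to the plane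
`z_i = y` for `i ∈ W` and `z_i = x` for `i ∉ W`. -/
noncomputable def monomialCoeff (n : ℕ) (W J : Finset α) (l : Multiset (Option α)) (q : ℕ) : ℝ :=
  if FitsIn J l ∧
    (J.filter fun a => some a ∉ l ∧ a ∈ W).card = q
  then ((n - J.card).descFactorial (l.count none) : ℝ) else 0

lemma fitsIn_none_cons_iff (J : Finset α) (l : Multiset (Option α)) :
    FitsIn J (none ::ₘ l) ↔ FitsIn J l := by
  simp [FitsIn]

lemma fitsIn_some_cons_iff (J : Finset α) (l : Multiset (Option α)) (a : α) :
    FitsIn J (some a ::ₘ l) ↔ FitsIn J l ∧ a ∈ J ∧ some a ∉ l := by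
  constructor
  · intro h
    have h1 := h a
    rw [Multiset.count_cons_self] at h1
    refine ⟨fun b => (Multiset.count_le_of_le _ (Multiset.le_cons_self l _)).trans (h b), ?_⟩
    split_ifs at h1 with haJ
    · exact ⟨haJ, Multiset.count_eq_zero.1 (by omega)⟩
    · omega
  · rintro ⟨h1, h2, h3⟩ b
    rw [Multiset.count_cons]
    split_ifs with h h'
    · rw [Option.some.injEq] at h
      subst h
      rw [Multiset.count_eq_zero.2 h3]
    · rw [Option.some.injEq] at h
      subst h
      exact absurd h2 h'
    · simpa [*] using h1 b
    · simpa [*] using h1 b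

lemma monomialCoeff_some_cons_of_mem (n : ℕ) {W : Finset α} (J : Finset α)
    (l : Multiset (Option α)) (q : ℕ) {a : α} (ha : a ∈ W) :
    monomialCoeff n W J (some a ::ₘ l) q
      = if a ∈ J ∧ some a ∉ l then monomialCoeff n W J l (q + 1) else 0 := by
  unfold monomialCoeff
  by_cases h : a ∈ J ∧ some a ∉ l
  · have hset : (J.filter fun b => some b ∉ some a ::ₘ l ∧ b ∈ W)
        = (J.filter fun b => some b ∉ l ∧ b ∈ W).erase a := by
      ext b
      simp only [Finset.mem_filter, Finset.mem_erase, Multiset.mem_cons, Option.some.injEq]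
      tauto
    have hmem : a ∈ J.filter fun b => some b ∉ l ∧ b ∈ W := by simp [h.1, h.2, ha]
    have hpos := Finset.card_pos.2 ⟨a, hmem⟩
    have hiff : (J.filter fun b => some b ∉ some a ::ₘ l ∧ b ∈ W).card = q ↔
        (J.filter fun b => some b ∉ l ∧ b ∈ W).card = q + 1 := by
      rw [hset, Finset.card_erase_of_mem hmem]; omega
    rw [if_pos h, Multiset.count_cons_of_ne (by simp)]
    exact if_congr (and_congr (by simp [fitsIn_some_cons_iff, h]) hiff) rfl rfl
  · rw [if_neg h, if_neg fun h' => h ((fitsIn_some_cons_iff J l a).1 h'.1).2]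

lemma monomialCoeff_some_cons_of_notMem (n : ℕ) {W : Finset α} (J : Finset α)
    (l : Multiset (Option α)) (q : ℕ) {a : α} (ha : a ∉ W) :
    monomialCoeff n W J (some a ::ₘ l) q
      = if a ∈ J ∧ some a ∉ l then monomialCoeff n W J l q else 0 := by
  unfold monomialCoeff
  by_cases h : a ∈ J ∧ some a ∉ l
  · have hset : (J.filter fun b => some b ∉ some a ::ₘ l ∧ b ∈ W)
        = J.filter fun b => some b ∉ l ∧ b ∈ W := by
      refine Finset.filter_congr fun b _ => ?_
      simp only [Multiset.mem_cons, Option.some.injEq]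
      refine ⟨fun hb => ⟨fun hb' => hb.1 (Or.inr hb'), hb.2⟩, fun hb => ⟨?_, hb.2⟩⟩
      rintro (rfl | hb')
      · exact ha hb.2
      · exact hb.1 hb'
    rw [if_pos h, Multiset.count_cons_of_ne (by simp), hset]
    exact if_congr (and_congr_left fun _ => by simp [fitsIn_some_cons_iff, h]) rfl rfl
  · rw [if_neg h, if_neg fun h' => h ((fitsIn_some_cons_iff J l a).1 h'.1).2]

variable [Fintype α]


lemma FitsIn.card_add_card_filter {J : Finset α} {l : Multiset (Option α)} (h : FitsIn J l) :
    l.card + (J.filter fun a => some a ∉ l).card = l.count none + J.card := by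
  rw [← Multiset.sum_count_eq_card (s := Finset.univ) (fun _ _ => Finset.mem_univ _),
    Fintype.sum_option, add_assoc]
  congr 1
  rw [← Finset.card_filter_add_card_filter_not (s := J) (fun a => some a ∈ l)]
  congr 1
  rw [Finset.card_filter, ← Finset.sum_subset (Finset.subset_univ J)]
  · refine Finset.sum_congr rfl fun a ha => ?_
    have h1 := h a
    rw [if_pos ha] at h1
    split_ifs with hal
    · exact le_antisymm h1 (Multiset.one_le_count_iff_mem.2 hal)
    · exact Multiset.count_eq_zero.2 hal
  · intro a _ ha
    have h1 := h a
    rw [if_neg ha] at h1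
    omega

/-- This is `∂/∂y` of `y ^ (q + 1)`: the factor counts the elements of `J ∩ W` not yet used by `l`.
-/
lemma sum_monomialCoeff_true (n : ℕ) (W J : Finset α) (l : Multiset (Option α)) (q : ℕ) :
    ∑ i, sideVector W true i * monomialCoeff n W J (i ::ₘ l) q
      = (q + 1) * monomialCoeff n W J l (q + 1) := by
  have h1 : ∀ a, sideVector W true (some a) * monomialCoeff n W J (some a ::ₘ l) q
      = if a ∈ J.filter (fun a => some a ∉ l ∧ a ∈ W) then monomialCoeff n W J l (q + 1)
        else 0 := by
    intro a
    by_cases ha : a ∈ W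
    · simp [sideVector, ha, monomialCoeff_some_cons_of_mem]
    · simp [sideVector, ha]
  rw [Fintype.sum_option, Finset.sum_congr rfl fun a _ => h1 a, Finset.sum_ite_mem,
    Finset.univ_inter, Finset.sum_const, nsmul_eq_mul]
  simp only [sideVector, zero_mul, zero_add]
  by_cases hq : (J.filter fun a => some a ∉ l ∧ a ∈ W).card = q + 1
  · rw [hq]; push_cast; ring
  · have : monomialCoeff n W J l (q + 1) = 0 := by
      unfold monomialCoeff; rw [if_neg fun h => hq h.2]
    simp [this]

/-- This is `∂/∂x` of `x ^ p`: the exponent is the remaining power of `z₀` plus the number of unused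
elements of `J` outside `W`, which equals `p` by homogeneity. -/
lemma sum_monomialCoeff_false {n : ℕ} {W J : Finset α} (l : Multiset (Option α)) {p q : ℕ}
    (hJ : J.card ≤ n) (hn : l.card + p + q = n) :
    ∑ i, sideVector W false i * monomialCoeff n W J (i ::ₘ l) q
      = p * monomialCoeff n W J l q := by
  have h1 : ∀ a, sideVector W false (some a) * monomialCoeff n W J (some a ::ₘ l) q
      = if a ∈ J.filter (fun a => some a ∉ l ∧ a ∉ W) then monomialCoeff n W J l q
        else 0 := by
    intro a
    by_cases ha : a ∈ W
    · simp [sideVector, ha]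
    · simp [sideVector, ha, monomialCoeff_some_cons_of_notMem]
  rw [Fintype.sum_option, Finset.sum_congr rfl fun a _ => h1 a, Finset.sum_ite_mem,
    Finset.univ_inter, Finset.sum_const, nsmul_eq_mul]
  simp only [sideVector, one_mul]
  have hnone : monomialCoeff n W J (none ::ₘ l) q = if FitsIn J l ∧
      (J.filter fun a => some a ∉ l ∧ a ∈ W).card = q
      then ((n - J.card).descFactorial (l.count none + 1) : ℝ) else 0 := by
    unfold monomialCoeff
    rw [Multiset.count_cons_self]
    exact if_congr (and_congr (fitsIn_none_cons_iff J l) (by simp)) rfl rfl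
  rw [hnone]
  unfold monomialCoeff
  by_cases h : FitsIn J l ∧
    (J.filter fun a => some a ∉ l ∧ a ∈ W).card = q
  swap
  · simp [h]
  simp only [if_pos h]
  have hc := FitsIn.card_add_card_filter h.1
  have hs : (J.filter fun a => some a ∉ l ∧ a ∈ W).card
      + (J.filter fun a => some a ∉ l ∧ a ∉ W).card = (J.filter fun a => some a ∉ l).card := by
    rw [← Finset.card_filter_add_card_filter_not (s := J.filter fun a => some a ∉ l) (· ∈ W),
      Finset.filter_filter, Finset.filter_filter]
  rw [h.2] at hs
  set e := (J.filter fun a => some a ∉ l ∧ a ∉ W).card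
  rw [Nat.descFactorial_succ]
  by_cases hr : l.count none ≤ n - J.card
  · have : p = (n - J.card - l.count none) + e := by omega
    rw [this]
    push_cast
    ring
  · rw [Nat.descFactorial_of_lt (not_le.1 hr)]
    simp

/-- At top order only the monomial of the set `I` of elements in `l` survives: a larger `J` has `n -
|J| < n - |I| = l.count none`, so its falling factorial is `0`. -/
lemma indepWeight_eq_sum (M : Matroid α) (W : Finset α) (l : Multiset (Option α))
    (hl : l.card = Fintype.card α) :
    M.indepWeight l
      = ∑ J ∈ M.indepFinsets, monomialCoeff (Fintype.card α) W J l 0 := by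
  have hset : {a | some a ∈ l} = ((Finset.univ.filter fun a => some a ∈ l : Finset α) : Set α) := by
    ext a; simp
  by_cases h : M.IndepMultiset l
  · set I : Finset α := Finset.univ.filter fun a => some a ∈ l with hI
    have hIi : M.Indep (I : Set α) := hset ▸ h.2
    have hfit : FitsIn I l := by
      intro a
      split_ifs with ha
      · exact h.1 a
      · exact (Multiset.count_eq_zero.2 fun h' => ha (by simpa [hI] using h')).le
    have hempty : (I.filter fun a => some a ∉ l) = ∅ := by
      ext a; simp [hI]
    rw [Finset.sum_eq_single_of_mem I (mem_indepFinsets.2 hIi)]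
    · have hc := FitsIn.card_add_card_filter hfit
      rw [hempty, Finset.card_empty, add_zero, hl] at hc
      unfold indepWeight monomialCoeff
      rw [if_pos h, if_pos, hc, Nat.add_sub_cancel, Nat.descFactorial_self]
      refine ⟨hfit, ?_⟩
      rw [← Finset.filter_filter, hempty]
      simp
    · intro J _ hJI
      unfold monomialCoeff
      split_ifs with hJ
      · have hIJ : I ⊆ J := by
          intro a ha
          have h1 := hJ.1 a
          have h2 : 1 ≤ l.count (some a) :=
            Multiset.one_le_count_iff_mem.2 (by simpa [hI] using ha)
          by_contra haJ
          rw [if_neg haJ] at h1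
          omega
        have h3 := Finset.card_lt_card (hIJ.ssubset_of_ne (Ne.symm hJI))
        have hc := FitsIn.card_add_card_filter hfit
        rw [hempty, Finset.card_empty, add_zero, hl] at hc
        rw [Nat.descFactorial_of_lt, Nat.cast_zero]
        have := J.card_le_univ
        have hr : 0 < l.count none := by omega
        omega
      · rfl
  · have h0 : M.indepWeight l = 0 := by
      by_contra h'
      exact h ((M.indepWeight_ne_zero_iff l).1 h')
    rw [h0]
    symm
    refine Finset.sum_eq_zero fun J hJ => ?_
    unfold monomialCoeff
    rw [if_neg]
    rintro ⟨h1, -⟩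
    refine h ⟨fun a => (h1 a).trans (by split_ifs <;> simp),
      (mem_indepFinsets.1 hJ).subset fun a ha => ?_⟩
    by_contra haJ
    have h2 := h1 a
    rw [if_neg (by simpa using haJ)] at h2
    have : 1 ≤ l.count (some a) := Multiset.one_le_count_iff_mem.2 ha
    omega

lemma mixedForm_sideVector (M : Matroid α) (W : Finset α) :
    ∀ (bs : List Bool) (l : Multiset (Option α)), l.card + bs.length = Fintype.card α →
      mixedForm M.indepWeight (bs.map (sideVector W)) l
        = (bs.count false).factorial * (bs.count true).factorial *
          ∑ J ∈ M.indepFinsets,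
            monomialCoeff (Fintype.card α) W J l (bs.count true)
  | [], l, hl => by
    simp [mixedForm, indepWeight_eq_sum M W l (by simpa using hl)]
  | b :: bs, l, hl => by
    have hlen : bs.count false + bs.count true = bs.length := by
      rw [add_comm]; exact List.count_true_add_count_false bs
    have ih : ∀ i, mixedForm M.indepWeight (bs.map (sideVector W)) (i ::ₘ l) = _ := fun i =>
      mixedForm_sideVector M W bs (i ::ₘ l) (by
        simp only [Multiset.card_cons, List.length_cons] at hl ⊢; omega)
    simp only [List.map_cons, mixedForm, ih]
    simp only [mul_left_comm (sideVector W b _), ← Finset.mul_sum]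
    have hswap : ∑ i, sideVector W b i * ∑ J ∈ M.indepFinsets,
          monomialCoeff (Fintype.card α) W J (i ::ₘ l) (bs.count true)
        = ∑ J ∈ M.indepFinsets, ∑ i, sideVector W b i *
          monomialCoeff (Fintype.card α) W J (i ::ₘ l) (bs.count true) := by
      simp only [Finset.mul_sum]
      rw [Finset.sum_comm]
    rw [hswap]
    cases b with
    | true =>
      simp only [sum_monomialCoeff_true, ← Finset.mul_sum, List.count_cons_self]
      rw [List.count_cons_of_ne (by simp), Nat.factorial_succ]
      push_cast
      ring
    | false =>
      have h1 : ∀ J : Finset α, ∑ i, sideVector W false i *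
          monomialCoeff (Fintype.card α) W J (i ::ₘ l) (bs.count true)
          = ((bs.count false + 1 : ℕ) : ℝ)
            * monomialCoeff (Fintype.card α) W J l (bs.count true) := fun J =>
        sum_monomialCoeff_false l J.card_le_univ (by
          simp only [List.length_cons] at hl; omega)
      simp only [h1, ← Finset.mul_sum, List.count_cons_self]
      rw [List.count_cons_of_ne (by simp), Nat.factorial_succ]
      push_cast
      ring

/-- The number of independent sets of a matroid which meet `W` in exactly `k` elements. -/
noncomputable def numIndepMeeting (M : Matroid α) (W : Finset α) (k : ℕ) : ℕ :=
  (M.indepFinsets.filter fun J => (J ∩ W).card = k).card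

lemma mixedForm_sideVector_zero (M : Matroid α) (W : Finset α) (bs : List Bool)
    (h : bs.length = Fintype.card α) :
    mixedForm M.indepWeight (bs.map (sideVector W)) 0
      = (bs.count false).factorial * (bs.count true).factorial
        * M.numIndepMeeting W (bs.count true) := by
  rw [mixedForm_sideVector M W bs 0 (by simpa using h)]
  congr 1
  unfold numIndepMeeting monomialCoeff
  rw [Finset.card_filter]
  push_cast
  refine Finset.sum_congr rfl fun J _ => ?_
  rw [Multiset.count_zero, Nat.descFactorial_zero, Nat.cast_one]
  exact if_congr (by simp [FitsIn, Finset.filter_mem_eq_inter]) rfl rfl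

end Matroid

/-! ### Ultra log-concavity for independent sets meeting a fixed set -/

namespace Matroid

variable {α : Type*} [DecidableEq α]

open Matrix Topology Filter

lemma sideVector_add_mul_pos (W : Finset α) {ε : ℝ} (hε : 0 < ε) (b : Bool) (i : Option α) :
    0 < sideVector W b i + ε * sideVector W (!b) i := by
  cases b <;> cases i <;> simp only [sideVector, Bool.not_true, Bool.not_false] <;>
    (try split_ifs) <;> norm_num <;> exact hε

variable [Fintype α]

/-- The side vectors have zero entries, whereas the Lorentzian property is available along positive
directions. Mixing in `ε` times the opposite side makes them positive, and the inequality survives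
as `ε → 0⁺`. -/
lemma mixedForm_sideVector_log_concave (M : Matroid α) (W : Finset α) (bs : List Bool)
    (h : bs.length + 2 = Fintype.card α) :
    mixedForm M.indepWeight ((false :: false :: bs).map (sideVector W)) 0 *
        mixedForm M.indepWeight ((true :: true :: bs).map (sideVector W)) 0
      ≤ mixedForm M.indepWeight ((false :: true :: bs).map (sideVector W)) 0 ^ 2 := by
  set v : ℝ → Bool → Option α → ℝ := fun ε b i => sideVector W b i + ε * sideVector W (!b) i
    with hv
  have hv0 : v 0 = sideVector W := by
    funext b i; simp [hv]
  have hcont : ∀ bs : List Bool,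
      Tendsto (fun ε => mixedForm M.indepWeight (bs.map (v ε)) 0) (𝓝[>] 0)
        (𝓝 (mixedForm M.indepWeight (bs.map (sideVector W)) 0)) := by
    intro bs
    have hc := continuous_mixedForm M.indepWeight v
      (fun b i => by simp only [hv]; fun_prop) bs 0
    have := hc.tendsto 0
    rw [hv0] at this
    exact this.mono_left nhdsWithin_le_nhds
  refine le_of_tendsto_of_tendsto ((hcont _).mul (hcont _)) ((hcont _).pow 2) ?_
  filter_upwards [self_mem_nhdsWithin] with ε hε
  have hpos : ∀ b i, 0 < v ε b i := sideVector_add_mul_pos W hε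
  have hlor := mixedMatrix_isLorentzian M.indepWeight_nonneg (o := none)
    (fun i l hl => by
      rw [indepWeight_ne_zero_iff] at hl ⊢
      exact (M.indepMultiset_none_cons l).2 hl.of_cons) (Fintype.card α)
    M.mixedMatrix_indepWeight_isLorentzian (bs.map (v ε)) (by
      intro u hu i
      obtain ⟨b, -, rfl⟩ := List.mem_map.1 hu
      exact hpos b i) 0 (by simpa using h)
  have h1 := hlor (v ε false) (v ε true)
  simp only [dotProduct_mixedMatrix_mulVec] at h1
  refine h1 (mixedForm_nonneg M.indepWeight_nonneg _ ?_ 0)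
  intro u hu i
  simp only [List.mem_cons, List.mem_map] at hu
  rcases hu with rfl | rfl | ⟨b, -, rfl⟩ <;> exact hpos _ i

lemma numIndepMeeting_eq_zero (M : Matroid α) (W : Finset α) {k : ℕ} (hk : Fintype.card α < k) :
    M.numIndepMeeting W k = 0 := by
  rw [numIndepMeeting, Finset.card_eq_zero, Finset.filter_eq_empty_iff]
  intro J _ hJ
  have := (J ∩ W).card_le_univ
  omega

lemma numIndepMeeting_ne_zero_of_le (M : Matroid α) (W : Finset α) {j k : ℕ} (hkj : k ≤ j)
    (hj : M.numIndepMeeting W j ≠ 0) : M.numIndepMeeting W k ≠ 0 := by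
  rw [numIndepMeeting, Finset.card_ne_zero] at hj ⊢
  obtain ⟨J, hJ⟩ := hj
  rw [Finset.mem_filter, mem_indepFinsets] at hJ
  obtain ⟨K, hK, hKc⟩ := Finset.exists_subset_card_eq (hkj.trans hJ.2.ge)
  refine ⟨K, Finset.mem_filter.2 ⟨mem_indepFinsets.2 (hJ.1.subset ?_), ?_⟩⟩
  · exact_mod_cast hK.trans Finset.inter_subset_left
  · rwa [Finset.inter_eq_left.2 (hK.trans Finset.inter_subset_right)]

lemma numIndepMeeting_factorial_log_concave (M : Matroid α) (W : Finset α) (p q : ℕ)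
    (h : p + q + 2 = Fintype.card α) :
    ((p + 2).factorial * q.factorial * M.numIndepMeeting W q : ℝ) *
        (p.factorial * (q + 2).factorial * M.numIndepMeeting W (q + 2))
      ≤ ((p + 1).factorial * (q + 1).factorial * M.numIndepMeeting W (q + 1)) ^ 2 := by
  have h1 := M.mixedForm_sideVector_log_concave W
    (List.replicate p false ++ List.replicate q true) (by simpa using h)
  rw [mixedForm_sideVector_zero _ _ _ (by simpa using h),
    mixedForm_sideVector_zero _ _ _ (by simpa using h),
    mixedForm_sideVector_zero _ _ _ (by simpa using h)] at h1
  simpa [List.count_cons, List.count_replicate] using h1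

/-- The numbers of independent sets of a matroid on `n` elements which meet a given set in exactly
`k` elements form an ultra log-concave sequence with respect to `n`. -/
theorem isUltraLogConcave_numIndepMeeting (M : Matroid α) (W : Finset α) :
    IsUltraLogConcave (Fintype.card α) (fun k => (M.numIndepMeeting W k : ℝ)) where
  nonneg k := Nat.cast_nonneg _
  eq_zero k hk := by simp [M.numIndepMeeting_eq_zero W hk]
  no_internal_zeros i k j _ hkj _ hj := by
    exact_mod_cast M.numIndepMeeting_ne_zero_of_le W hkj.le (by exact_mod_cast hj)
  ineq k hk := by
    obtain ⟨q, rfl⟩ : ∃ q, k = q + 1 := ⟨k - 1, by omega⟩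
    by_cases hn : q + 2 ≤ Fintype.card α
    swap
    · rw [show ((M.numIndepMeeting W (q + 1 + 1) : ℕ) : ℝ) = 0 by
        exact_mod_cast M.numIndepMeeting_eq_zero W (by omega)]
      simp only [zero_div, mul_zero]
      positivity
    obtain ⟨p, hp⟩ : ∃ p, p + q + 2 = Fintype.card α := ⟨Fintype.card α - (q + 2), by omega⟩
    have key := M.numIndepMeeting_factorial_log_concave W p q hp
    set n := Fintype.card α
    -- Dividing by the binomial coefficient produces exactly the factorials of the mixed
    -- derivatives, up to the common `n!`.
    have hchoose : ∀ {a b : ℕ}, a + b = n → ∀ x : ℝ,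
        x / (n.choose b : ℝ) = a.factorial * b.factorial * x / n.factorial := by
      intro a b hab x
      have h1 := Nat.add_choose_mul_factorial_mul_factorial a b
      rw [hab] at h1
      have h3 : (n.choose b : ℝ) * a.factorial * b.factorial = n.factorial := by exact_mod_cast h1
      have h4 : (0 : ℝ) < n.choose b := by
        exact_mod_cast Nat.choose_pos (by omega)
      have h5 : (0 : ℝ) < n.factorial := by exact_mod_cast n.factorial_pos
      rw [div_eq_div_iff h4.ne' h5.ne', ← h3]
      ring
    rw [← div_pow, Nat.add_sub_cancel, hchoose (a := p + 1) (b := q + 1) (by omega),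
      hchoose (a := p + 2) (b := q) (by omega), hchoose (a := p) (b := q + 1 + 1) (by omega),
      div_mul_div_comm, div_pow, sq (n.factorial : ℝ)]
    exact div_le_div_of_nonneg_right key (by positivity)

end Matroid

/-! ### From bimatroids to matroids -/

namespace Bimatroid

section

variable {E : Type*} {F : Type*}

/-- The subset `(E \ I) ∪ J` of the disjoint union of `E` and `F`. -/
def minorBase (I : Finset E) (J : Finset F) : Set (E ⊕ F) :=
  {x | Sum.elim (fun e => e ∉ I) (fun f => f ∈ J) x}

@[simp] lemma inl_mem_minorBase {I : Finset E} {J : Finset F} {e : E} :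
    Sum.inl e ∈ minorBase I J ↔ e ∉ I := Iff.rfl

@[simp] lemma inr_mem_minorBase {I : Finset E} {J : Finset F} {f : F} :
    Sum.inr f ∈ minorBase I J ↔ f ∈ J := Iff.rfl

lemma minorBase_injective {I I' : Finset E} {J J' : Finset F}
    (h : minorBase I J = minorBase I' J') : I = I' ∧ J = J' := by
  refine ⟨Finset.ext fun e => ?_, Finset.ext fun f => ?_⟩
  · have : Sum.inl e ∈ minorBase I J ↔ Sum.inl e ∈ minorBase I' J' := by rw [h]
    simpa [not_iff_not] using this
  · have : Sum.inr f ∈ minorBase I J ↔ Sum.inr f ∈ minorBase I' J' := by rw [h]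
    simpa using this

end

variable {E : Type*} {F : Type*} [DecidableEq E] [DecidableEq F]

lemma relRank_eq_card_right_iff (A : Bimatroid E F) (S : Finset E) (T : Finset F) :
    A.relRank S T = T.card ↔ ∃ I ⊆ S, A.IsRegularMinor I T := by
  classical
  have hle : ∀ I J, I ⊆ S → J ⊆ T → A.IsRegularMinor I J → I.card ≤ T.card := fun I J _ hJ h =>
    (A.card_eq I J h).trans_le (Finset.card_le_card hJ)
  unfold relRank
  constructor
  · intro h
    obtain ⟨p, hp, hpe⟩ := Finset.exists_mem_eq_sup
      ((S.powerset ×ˢ T.powerset).filter fun p => A.IsRegularMinor p.1 p.2)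
      ⟨(∅, ∅), by simp [A.empty]⟩ (fun p => p.1.card)
    simp only [Finset.mem_filter, Finset.mem_product, Finset.mem_powerset] at hp
    rw [h] at hpe
    have h2 : p.2 = T := Finset.eq_of_subset_of_card_le hp.1.2 (by
      rw [← A.card_eq _ _ hp.2, hpe])
    exact ⟨p.1, hp.1.1, h2 ▸ hp.2⟩
  · rintro ⟨I, hI, hreg⟩
    refine le_antisymm (Finset.sup_le fun p hp => ?_) ?_
    · simp only [Finset.mem_filter, Finset.mem_product, Finset.mem_powerset] at hp
      exact hle _ _ hp.1.1 hp.1.2 hp.2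
    · rw [← A.card_eq I T hreg]
      exact Finset.le_sup (f := fun p : Finset E × Finset F => p.1.card)
        (b := (I, T)) (by simp [hI, hreg])

lemma relRank_eq_card_left_iff (A : Bimatroid E F) (S : Finset E) (T : Finset F) :
    A.relRank S T = S.card ↔ ∃ J ⊆ T, A.IsRegularMinor S J := by
  classical
  unfold relRank
  constructor
  · intro h
    obtain ⟨p, hp, hpe⟩ := Finset.exists_mem_eq_sup
      ((S.powerset ×ˢ T.powerset).filter fun p => A.IsRegularMinor p.1 p.2)
      ⟨(∅, ∅), by simp [A.empty]⟩ (fun p => p.1.card)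
    simp only [Finset.mem_filter, Finset.mem_product, Finset.mem_powerset] at hp
    rw [h] at hpe
    have h2 : p.1 = S := Finset.eq_of_subset_of_card_le hp.1.1 hpe.le
    exact ⟨p.2, hp.1.2, h2 ▸ hp.2⟩
  · rintro ⟨J, hJ, hreg⟩
    refine le_antisymm (Finset.sup_le fun p hp => ?_) ?_
    · simp only [Finset.mem_filter, Finset.mem_product, Finset.mem_powerset] at hp
      exact Finset.card_le_card hp.1.1
    · exact Finset.le_sup (f := fun p : Finset E × Finset F => p.1.card)
        (b := (S, J)) (by simp [hJ, hreg])

lemma isVerticalRegularRectangle_iff (A : Bimatroid E F) (S : Finset E) (T : Finset F) :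
    A.IsVerticalRegularRectangle S T ↔ ∃ I ⊆ S, A.IsRegularMinor I T := by
  rw [IsVerticalRegularRectangle, relRank_eq_card_right_iff, and_iff_left_iff_imp]
  rintro ⟨I, hI, h⟩
  exact A.card_eq I T h ▸ Finset.card_le_card hI

lemma isHorizontalRegularRectangle_iff (A : Bimatroid E F) (S : Finset E) (T : Finset F) :
    A.IsHorizontalRegularRectangle S T ↔ ∃ J ⊆ T, A.IsRegularMinor S J := by
  rw [IsHorizontalRegularRectangle, relRank_eq_card_left_iff, and_iff_left_iff_imp]
  rintro ⟨J, hJ, h⟩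
  exact (A.card_eq S J h).symm ▸ Finset.card_le_card hJ

variable [Fintype E] [Fintype F]

/-- The matroid on the disjoint union of `E` and `F` whose bases are the sets `(E \ I) ∪ J` for the
regular minors `(I, J)` of a bimatroid. -/
def toMatroid (A : Bimatroid E F) : Matroid (E ⊕ F) :=
  Matroid.ofIsBaseOfFinite (E := Set.univ) Set.finite_univ
    (fun B => ∃ I J, A.IsRegularMinor I J ∧ B = minorBase I J)
    ⟨_, ∅, ∅, A.empty, rfl⟩
    (by
      rintro _ _ ⟨I, J, h, rfl⟩ ⟨I', J', h', rfl⟩ (e | f) hx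
      -- Removing an element of `E` from a base enlarges `I`, so the row axiom is basis exchange at
      -- elements of `E`; the column axiom is basis exchange at elements of `F`.
      · simp only [Set.mem_sdiff, inl_mem_minorBase, not_not] at hx
        rcases A.exchange_row I J I' J' h h' e (by simp [hx]) with ⟨i, hi, hr⟩ | ⟨j, hj, hr⟩
        · rw [Finset.mem_sdiff] at hi
          refine ⟨Sum.inl i, by simp [hi], _, _, hr, ?_⟩
          ext (x | x)
          · by_cases hxe : x = e
            · have : x ≠ i := by rintro rfl; exact hx.1 (hxe ▸ hi.1)
              simp [hxe, hxe ▸ this]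
            · simp [hxe]; tauto
          · simp
        · rw [Finset.mem_sdiff] at hj
          refine ⟨Sum.inr j, by simp [hj], _, _, hr, ?_⟩
          ext (x | x)
          · simp; tauto
          · simp
      · simp only [Set.mem_sdiff, inr_mem_minorBase] at hx
        rcases A.exchange_col I J I' J' h h' f (by simp [hx]) with ⟨j, hj, hr⟩ | ⟨i, hi, hr⟩
        · rw [Finset.mem_sdiff] at hj
          refine ⟨Sum.inr j, by simp [hj], _, _, hr, ?_⟩
          ext (x | x)
          · simp
          · simp; tauto
        · rw [Finset.mem_sdiff] at hi
          refine ⟨Sum.inl i, by simp [hi], _, _, hr, ?_⟩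
          ext (x | x)
          · simp; tauto
          · simp; tauto)
    (fun _ _ => Set.subset_univ _)

lemma toMatroid_isBase_iff (A : Bimatroid E F) (B : Set (E ⊕ F)) :
    A.toMatroid.IsBase B ↔ ∃ I J, A.IsRegularMinor I J ∧ B = minorBase I J := Iff.rfl

@[simp] lemma toMatroid_ground (A : Bimatroid E F) : A.toMatroid.E = Set.univ := rfl

lemma toMatroid_isBase_minorBase_iff (A : Bimatroid E F) (I : Finset E) (J : Finset F) :
    A.toMatroid.IsBase (minorBase I J) ↔ A.IsRegularMinor I J := by
  rw [toMatroid_isBase_iff]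
  constructor
  · rintro ⟨I', J', h, he⟩
    obtain ⟨rfl, rfl⟩ := minorBase_injective he
    exact h
  · exact fun h => ⟨I, J, h, rfl⟩

lemma isVerticalRegularRectangle_iff_indep (A : Bimatroid E F) (S : Finset E) (T : Finset F) :
    A.IsVerticalRegularRectangle S T ↔ A.toMatroid.Indep (Sᶜ.disjSum T : Finset (E ⊕ F)) := by
  rw [isVerticalRegularRectangle_iff]
  have hset : ((Sᶜ.disjSum T : Finset (E ⊕ F)) : Set (E ⊕ F)) = minorBase S T := by
    ext (x | x) <;> simp
  rw [hset]
  constructor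
  · rintro ⟨I, hI, h⟩
    refine ((A.toMatroid_isBase_minorBase_iff I T).2 h).indep.subset ?_
    rintro (x | x) hx
    · exact fun hxI => hx (hI hxI)
    · exact hx
  · intro h
    -- The base of the empty minor is `E` itself. Extending by elements of `E` only leaves the part
    -- in `F` equal to `T`.
    obtain ⟨B, hB, hsub, hB'⟩ := h.exists_isBase_subset_union_isBase
      ((A.toMatroid_isBase_minorBase_iff ∅ ∅).2 A.empty)
    obtain ⟨I, J, hreg, rfl⟩ := (A.toMatroid_isBase_iff B).1 hB
    have hJ : J = T := by
      ext f
      refine ⟨fun hf => ?_, fun hf => @hsub (Sum.inr f) hf⟩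
      simpa using @hB' (Sum.inr f) hf
    refine ⟨I, fun e he => ?_, hJ ▸ hreg⟩
    by_contra heS
    exact @hsub (Sum.inl e) heS he

lemma isHorizontalRegularRectangle_iff_indep (A : Bimatroid E F) (S : Finset E) (T : Finset F) :
    A.IsHorizontalRegularRectangle S T ↔
      A.toMatroid.dual.Indep (S.disjSum Tᶜ : Finset (E ⊕ F)) := by
  rw [isHorizontalRegularRectangle_iff]
  have hset : ((S.disjSum Tᶜ : Finset (E ⊕ F)) : Set (E ⊕ F)) = (minorBase S T)ᶜ := by
    ext (x | x) <;> simp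
  have hdual : ∀ B, A.toMatroid.dual.IsBase B ↔ A.toMatroid.IsBase Bᶜ := fun B => by
    rw [Matroid.dual_isBase_iff (by simp), toMatroid_ground, Set.compl_eq_univ_sdiff]
  rw [hset]
  constructor
  · rintro ⟨J, hJ, h⟩
    have hB : A.toMatroid.dual.IsBase (minorBase S J)ᶜ := by
      rw [hdual, compl_compl, toMatroid_isBase_minorBase_iff]; exact h
    refine hB.indep.subset (Set.compl_subset_compl.2 ?_)
    rintro (x | x) hx
    · exact hx
    · exact hJ hx
  · intro h
    -- Dually, `F` is a base of the dual, and extending inside it leaves the part in `E` equal to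
    -- `S`.
    obtain ⟨B, hB, hsub, hB'⟩ := h.exists_isBase_subset_union_isBase (B := (minorBase ∅ ∅)ᶜ)
      (by rw [hdual, compl_compl, toMatroid_isBase_minorBase_iff]; exact A.empty)
    rw [hdual] at hB
    obtain ⟨I, J, hreg, hBeq⟩ := (A.toMatroid_isBase_iff _).1 hB
    have hBeq' : B = (minorBase I J)ᶜ := by rw [← hBeq, compl_compl]
    subst hBeq'
    have hI : I = S := by
      ext e
      refine ⟨fun he => ?_, fun he => ?_⟩
      · simpa using @hB' (Sum.inl e) (by simpa using he)
      · simpa using @hsub (Sum.inl e) (by simpa using he)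
    refine ⟨J, fun f hf => ?_, hI ▸ hreg⟩
    by_contra hfT
    exact @hsub (Sum.inr f) hfT hf

lemma numVertical_eq (A : Bimatroid E F) (k : ℕ) :
    A.numVertical k
      = A.toMatroid.numIndepMeeting ((∅ : Finset E).disjSum (Finset.univ : Finset F)) k := by
  classical
  unfold numVertical Matroid.numIndepMeeting
  refine Finset.card_bij' (fun p _ => p.1ᶜ.disjSum p.2) (fun X _ => (X.toLeftᶜ, X.toRight))
    ?_ ?_ ?_ ?_
  · intro p hp
    have hint : (p.1ᶜ.disjSum p.2 ∩ (∅ : Finset E).disjSum (Finset.univ : Finset F))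
        = (∅ : Finset E).disjSum p.2 := by
      ext (x | x) <;> simp
    simp only [Finset.mem_filter, Finset.mem_univ, true_and] at hp
    rw [Finset.mem_filter, Matroid.mem_indepFinsets, ← isVerticalRegularRectangle_iff_indep, hint]
    simpa using hp
  · intro X hX
    have hint : (X ∩ (∅ : Finset E).disjSum (Finset.univ : Finset F))
        = (∅ : Finset E).disjSum X.toRight := by
      ext (x | x) <;> simp
    rw [Finset.mem_filter, Matroid.mem_indepFinsets, hint] at hX
    simp only [Finset.mem_filter, Finset.mem_univ, true_and]
    rw [isVerticalRegularRectangle_iff_indep, compl_compl, Finset.toLeft_disjSum_toRight]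
    simpa using hX
  · intro p _; simp
  · intro X _
    rw [compl_compl]
    exact Finset.toLeft_disjSum_toRight

lemma numHorizontal_eq (A : Bimatroid E F) (k : ℕ) :
    A.numHorizontal k
      = A.toMatroid.dual.numIndepMeeting ((Finset.univ : Finset E).disjSum (∅ : Finset F)) k := by
  classical
  unfold numHorizontal Matroid.numIndepMeeting
  refine Finset.card_bij' (fun p _ => p.1.disjSum p.2ᶜ) (fun X _ => (X.toLeft, X.toRightᶜ))
    ?_ ?_ ?_ ?_
  · intro p hp
    have hint : (p.1.disjSum p.2ᶜ ∩ (Finset.univ : Finset E).disjSum (∅ : Finset F))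
        = p.1.disjSum (∅ : Finset F) := by
      ext (x | x) <;> simp
    simp only [Finset.mem_filter, Finset.mem_univ, true_and] at hp
    rw [Finset.mem_filter, Matroid.mem_indepFinsets, ← isHorizontalRegularRectangle_iff_indep,
      hint]
    simpa using hp
  · intro X hX
    have hint : (X ∩ (Finset.univ : Finset E).disjSum (∅ : Finset F))
        = X.toLeft.disjSum (∅ : Finset F) := by
      ext (x | x) <;> simp
    rw [Finset.mem_filter, Matroid.mem_indepFinsets, hint] at hX
    simp only [Finset.mem_filter, Finset.mem_univ, true_and]
    rw [isHorizontalRegularRectangle_iff_indep, compl_compl, Finset.toLeft_disjSum_toRight]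
    simpa using hX
  · intro p _; simp
  · intro X _
    rw [compl_compl]
    exact Finset.toLeft_disjSum_toRight

end Bimatroid

theorem mainTheorem4 {E : Type*} {F : Type*} [Fintype E] [Fintype F] [DecidableEq E]
    [DecidableEq F] (A : Bimatroid E F) (N : ℕ) (hN : N = Fintype.card E + Fintype.card F) :
    IsUltraLogConcave N (fun k => (A.numVertical k : ℝ)) ∧
      IsUltraLogConcave N (fun k => (A.numHorizontal k : ℝ)) := by
  rw [hN, ← Fintype.card_sum]
  simp only [A.numVertical_eq, A.numHorizontal_eq]
  exact ⟨Matroid.isUltraLogConcave_numIndepMeeting _ _,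
    Matroid.isUltraLogConcave_numIndepMeeting _ _⟩
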